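/- A \emph{Maya diagram} is a set $M\subset\mathbb Z$ containing finitely many positive integers and excluding finitely many negative integers; $M+k=\{m+k: m\in M\}$. The \emph{flip} at $m\in\mathbb Z$ is $\phi_m(M)=M\cup\{m\}$ if $m\notin M$ and $\phi_m(M)=M\setminus\{m\}$ if $m\in M$, and $\Upsilon(M,M')=(M\setminus M')\cup(M'\setminus M)$. Let $H_n$ be the Hermite polynomials ($H_0=1$, $H_{-1}=0$, $H_{n+1}=2xH_n-2nH_{n-1}$) and $\tilde h_n(x)=\mathrm i^{-n}H_n(\mathrm i x)$. If $s_1>\dots>s_r$ are the elements of $\{-m-1: m\notin M,\ m<0\}$ and $t_1>\dots>t_q$ those of $\{m\in M: m\ge 0\}$ (these $s_j$ are unrelated to the signs $s_i$ below), the \emph{Hermite pseudo-Wronskian} of $M$ is $$H_M=e^{-rx^2}\,\mathrm{Wr}\big[e^{x^2}\tilde h_{s_1},\dots,e^{x^2}\tilde h_{s_r},H_{t_q},\dots,H_{t_1}\big].$$ \textbf{Theorem.} Let $M$ be a Maya diagram, $k$ a non-zero integer, $p$ the cardinality of the (finite) set $\Upsilon(M,M+k)$, and $\mu_0,\dots,\mu_{p-1}$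 an arbitrary enumeration of this set. Put $\mu_p=\mu_0+k$, $M_0=M$ and $M_{i+1}=\phi_{\mu_i}(M_i)$ for $i=0,\dots,p-1$. Then $M_p=M+k$, and each $H_{M_i}$ ($0\le i\le p$) is a polynomial that is not identically zero. Set, for $i=0,\dots,p-1$, $$w_i=s_i x+\frac{H_{M_{i+1}}'}{H_{M_{i+1}}}-\frac{H_{M_i}'}{H_{M_i}},\qquad \alpha_i=2(\mu_i-\mu_{i+1}),\qquad s_i=\begin{cases}-1,&\mu_i\notin M,\\ +1,&\mu_i\in M.\end{cases}$$ Then $(w_0,\dots,w_{p-1};\alpha_0,\dots,\alpha_{p-1})$ is a rational solution of the $p$-cyclic Darboux dressing chain with shift $\Delta=2k$: the $w_i$ are rational functions and, at every $x\in\mathbb C$ which is not a zero of any $H_{M_i}$ ($0\le i\le p$; there are only finitely many such zeros), $$(w_i+w_{i+1})'+w_{i+1}^2-w_i^2=\alpha_i,\qquad i=0,\dots,p-1,$$ with the index of $w$ taken modulo $p$, and $\Delta=-(\alpha_0+\dots+\alpha_{p-1})$. -/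

import Mathlib

/-- A Maya diagram: a set of integers containing finitely many positive integers and
excluding finitely many negative integers. -/
@[ext]
structure MayaDiagram where
  carrier : Set ℤ
  finite_pos : {m : ℤ | m ∈ carrier ∧ 0 < m}.Finite
  finite_neg : {m : ℤ | m ∉ carrier ∧ m < 0}.Finite

namespace MayaDiagram

/-- The translate `M + k = {m + k : m ∈ M}`. -/
def shift (M : MayaDiagram) (k : ℤ) : MayaDiagram where
  carrier := {n : ℤ | ∃ m ∈ M.carrier, n = m + k}
  finite_pos := by
    refine ((M.finite_pos.image (· + k)).union (Set.finite_Icc 1 k)).subset ?_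
    rintro n ⟨⟨m, hm, rfl⟩, hn⟩
    by_cases h : 0 < m
    · exact Or.inl ⟨m, ⟨hm, h⟩, rfl⟩
    · exact Or.inr ⟨by omega, by omega⟩
  finite_neg := by
    refine ((M.finite_neg.image (· + k)).union (Set.finite_Icc k (-1))).subset ?_
    rintro n ⟨hn, hneg⟩
    by_cases h : n - k < 0
    · exact Or.inl ⟨n - k, ⟨fun hm => hn ⟨n - k, hm, by ring⟩, h⟩, by simp⟩
    · exact Or.inr ⟨by omega, by omega⟩

open Classical in
/-- The flip `φ_m`: add `m` to `M` if `m ∉ M`, remove it if `m ∈ M`. -/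
noncomputable def flip (m : ℤ) (M : MayaDiagram) : MayaDiagram where
  carrier := if m ∈ M.carrier then M.carrier \ {m} else M.carrier ∪ {m}
  finite_pos := by
    refine (M.finite_pos.union (Set.finite_singleton m)).subset ?_
    rintro n ⟨hn, hpos⟩
    split_ifs at hn
    · exact Or.inl ⟨hn.1, hpos⟩
    · exact hn.imp (fun h => ⟨h, hpos⟩) id
  finite_neg := by
    refine (M.finite_neg.union (Set.finite_singleton m)).subset ?_
    rintro n ⟨hn, hneg⟩
    by_cases h : n = m
    · exact Or.inr h
    · refine Or.inl ⟨fun hm => hn ?_, hneg⟩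
      split_ifs
      · exact ⟨hm, h⟩
      · exact Or.inl hm

theorem finite_diff (M M' : MayaDiagram) : (M.carrier \ M'.carrier).Finite := by
  refine ((M.finite_pos.union M'.finite_neg).union (Set.finite_singleton 0)).subset ?_
  rintro n ⟨h, h'⟩
  rcases lt_trichotomy n 0 with h0 | h0 | h0
  · exact Or.inl (Or.inr ⟨h', h0⟩)
  · exact Or.inr h0
  · exact Or.inl (Or.inl ⟨h, h0⟩)

/-- `Υ(M, M') = (M \ M') ∪ (M' \ M)`, a finite set of integers. -/
noncomputable def upsilon (M M' : MayaDiagram) : Finset ℤ :=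
  ((finite_diff M M').union (finite_diff M' M)).toFinset

theorem finite_minus (M : MayaDiagram) : {n : ℕ | -(n : ℤ) - 1 ∉ M.carrier}.Finite := by
  refine Set.Finite.of_finite_image (f := fun n : ℕ => -(n : ℤ) - 1)
    (M.finite_neg.subset ?_) (fun a _ b _ h => by simpa using h)
  rintro _ ⟨n, hn, rfl⟩
  exact ⟨hn, by dsimp only; omega⟩

theorem finite_plus (M : MayaDiagram) : {n : ℕ | (n : ℤ) ∈ M.carrier}.Finite := by
  refine Set.Finite.of_finite_image (f := fun n : ℕ => (n : ℤ))
    ((M.finite_pos.union (Set.finite_singleton 0)).subset ?_) (fun a _ b _ h => by simpa using h)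
  rintro _ ⟨n, hn, rfl⟩
  rcases Nat.eq_zero_or_pos n with h | h
  · exact Or.inr (by simpa using h)
  · exact Or.inl ⟨hn, by simpa using h⟩

/-- `M₋ = {-m-1 : m ∉ M, m < 0}`, the first half of the Frobenius symbol. -/
noncomputable def minus (M : MayaDiagram) : Finset ℕ := M.finite_minus.toFinset

/-- `M₊ = {m : m ∈ M, m ≥ 0}`, the second half of the Frobenius symbol. -/
noncomputable def plus (M : MayaDiagram) : Finset ℕ := M.finite_plus.toFinset

end MayaDiagram

/-- The (physicists') Hermite polynomials `H_n`, by
`H_{n+1} = 2 x H_n - 2 n H_{n-1}`, `H_{-1} = 0`, `H_0 = 1`. -/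
noncomputable def hermiteH : ℕ → Polynomial ℂ
  | 0 => 1
  | 1 => 2 * Polynomial.X
  | (n + 2) => 2 * Polynomial.X * hermiteH (n + 1) - 2 * ((n : Polynomial ℂ) + 1) * hermiteH n

/-- The conjugate Hermite polynomial `i⁻ⁿ H_n(i x)`. -/
noncomputable def conjHermiteH (n : ℕ) : Polynomial ℂ :=
  Polynomial.C ((Complex.I ^ n)⁻¹) * (hermiteH n).comp (Polynomial.C Complex.I * Polynomial.X)

/-- The Wronskian determinant `Wr[f_1, …, f_n]` of functions of a complex variable. -/
noncomputable def wronskianDet {n : ℕ} (f : Fin n → ℂ → ℂ) (z : ℂ) : ℂ :=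
  (Matrix.of fun i j : Fin n => iteratedDeriv (j : ℕ) (f i) z).det

/-- The Hermite pseudo-Wronskian
`H_M = e^{-r x²} Wr[e^{x²} h_{s_1}, …, e^{x²} h_{s_r}, H_{t_q}, …, H_{t_1}]`, where
`s_1 > … > s_r` and `t_1 > … > t_q` are the elements of `M₋` and `M₊` and `h_n` is the
conjugate Hermite polynomial. -/
noncomputable def pseudoWronskian (M : MayaDiagram) (z : ℂ) : ℂ :=
  Complex.exp (-(M.minus.card : ℂ) * z ^ 2) *
    wronskianDet
      (Fin.append
        (fun (i : Fin M.minus.card) (x : ℂ) =>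
          Complex.exp (x ^ 2) * (conjHermiteH (M.minus.orderEmbOfFin rfl i.rev)).eval x)
        (fun (j : Fin M.plus.card) (x : ℂ) =>
          (hermiteH (M.plus.orderEmbOfFin rfl j)).eval x)) z

/-- `(w_0, …, w_{p-1}; a_0, …, a_{p-1})` satisfies on `U` the equations of the `p`-cyclic
Darboux dressing chain with shift `Δ`; indices are taken modulo `p` (`finRotate p i` is
`i + 1` modulo `p`). -/
structure IsCyclicDressingChainOn {p : ℕ} (U : Set ℂ) (w : Fin p → ℂ → ℂ) (a : Fin p → ℂ)
    (Δ : ℂ) : Prop where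
  differentiableAt : ∀ i, ∀ z ∈ U, DifferentiableAt ℂ (w i) z
  equation : ∀ i, ∀ z ∈ U,
    deriv (fun x => w i x + w (finRotate p i) x) z + w (finRotate p i) z ^ 2 - w i z ^ 2 = a i
  shift_eq : Δ = -∑ i, a i

/-- On `U`, the function `f` is a rational function without poles. -/
def IsRationalOn (U : Set ℂ) (f : ℂ → ℂ) : Prop :=
  ∃ P Q : Polynomial ℂ, ∀ z ∈ U, Q.eval z ≠ 0 ∧ f z = P.eval z / Q.eval z

/-- A rational solution of the `p`-cyclic dressing chain with shift `Δ`: off the finite set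
`Uᶜ` the functions are rational and satisfy the equations of the chain. -/
structure IsRationalDressingChainOn {p : ℕ} (U : Set ℂ) (w : Fin p → ℂ → ℂ) (a : Fin p → ℂ)
    (Δ : ℂ) : Prop extends IsCyclicDressingChainOn U w a Δ where
  finite_compl : Uᶜ.Finite
  rational : ∀ i, IsRationalOn U (w i)

/-! To a Maya diagram `M` attach the Schrödinger potential `U_M = x² - 2 (log H_M)'' + 2c - 1`,
where the charge `c` counts particles minus holes. If `M'` is the flip of `M` at `m`, the function
`w = ∓x + (log H_{M'} / H_M)'` solves both `w' + w² = U_M - 2m` and `-w' + w² = U_{M'} - 2m`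
(`riccati`). Along the chain of flips, the second equation for `w_i` and the first for `w_{i+1}`
involve the same potential; subtracting them leaves `2(μ_i - μ_{i+1})`. The chain closes up because
a translation by `k` changes `H_M` only by a constant (`pseudoWronskian_shift`) and the charge by
`k`, so `U_{M+k} = U_M + 2k`, which matches `μ_p = μ_0 + k`.

For `m ∉ M` both Riccati equations amount to one Hirota bilinear equation for `H_M` and `H_{M'}`
(`pseudoWronskian_bilinear`). Translating far enough to the right removes all holes, so `H_M`
becomes a Wronskian of Hermite polynomials and adding `m` inserts one more of them. There the
equation follows from a Plücker relation (`derivMinor_plucker`) and from Hermite's differential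
equation summed over the columns (`hermiteWronskian_ode`). The same reduction shows that `H_M` is a
non-zero polynomial (`hermiteWronskian_ne_zero`). -/

open Polynomial in
/-- The determinant of the derivatives of orders `c j` of the polynomials `f i`. -/
noncomputable def derivMinor {n : ℕ} (f : Fin n → ℂ[X]) (c : Fin n → ℕ) : ℂ[X] :=
  (Matrix.of fun i j : Fin n => derivative^[c j] (f i)).det

/-- The Wronskian of the Hermite polynomials of degrees `t i`. -/
noncomputable def hermiteWronskian {n : ℕ} (t : Fin n → ℕ) : Polynomial ℂ :=
  derivMinor (fun i => hermiteH (t i)) fun j => j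

/-! ### Minors of derivative matrices and the bilinear equation for Hermite Wronskians. -/

section Minors

open Polynomial

theorem derivMinor_eq_sum {n : ℕ} (f : Fin n → ℂ[X]) (c : Fin n → ℕ) :
    derivMinor f c =
      ∑ σ : Equiv.Perm (Fin n), Equiv.Perm.sign σ • ∏ j, derivative^[c j] (f (σ j)) := by
  simp [derivMinor, Matrix.det_apply]

theorem derivMinor_eq_zero {n : ℕ} (f : Fin n → ℂ[X]) {c : Fin n → ℕ} {i j : Fin n}
    (hij : i ≠ j) (h : c i = c j) : derivMinor f c = 0 :=
  Matrix.det_zero_of_column_eq hij fun k => by simp [h]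

theorem derivMinor_update {n : ℕ} (f : Fin n → ℂ[X]) (c : Fin n → ℕ) (j : Fin n) (k : ℕ) :
    derivMinor f (Function.update c j k) =
      ((Matrix.of fun i j : Fin n => derivative^[c j] (f i)).updateCol j
        fun i => derivative^[k] (f i)).det := by
  unfold derivMinor
  congr 1
  ext1 a b
  by_cases h : b = j
  · subst h; simp
  · simp [h]

theorem derivative_derivMinor {n : ℕ} (f : Fin n → ℂ[X]) (c : Fin n → ℕ) :
    derivative (derivMinor f c) = ∑ j, derivMinor f (Function.update c j (c j + 1)) := by
  simp only [derivMinor_eq_sum]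
  rw [Finset.sum_comm, derivative_sum]
  refine Finset.sum_congr rfl fun σ _ => ?_
  rw [← Finset.smul_sum, Units.smul_def, derivative_smul, derivative_prod_finset, Units.smul_def]
  congr 1
  refine Finset.sum_congr rfl fun j _ => ?_
  rw [← Finset.prod_erase_mul _ _ (Finset.mem_univ j), Function.update_self,
    Function.iterate_succ_apply']
  congr 1
  refine Finset.prod_congr rfl fun i hi => ?_
  rw [Function.update_of_ne (Finset.ne_of_mem_erase hi)]

theorem derivMinor_swap {n : ℕ} (f : Fin n → ℂ[X]) (c : Fin n → ℕ) {i j : Fin n} (h : i ≠ j) :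
    derivMinor f (c ∘ Equiv.swap i j) = -derivMinor f c := by
  have := Matrix.det_permute' (Equiv.swap i j) (Matrix.of fun i j : Fin n => derivative^[c j] (f i))
  rw [Equiv.Perm.sign_swap h] at this
  exact this.trans (by simp [derivMinor])

/-- In the Leibniz expansion the term of `σ` is multiplied by `d (σ j)`; summing over `j` gives `∑
i, d i`, the same for every `σ`. -/
theorem sum_det_updateCol_mul {n : ℕ} {R : Type*} [CommRing R] (A : Matrix (Fin n) (Fin n) R)
    (d : Fin n → R) :
    ∑ j, (A.updateCol j fun i => d i * A i j).det = (∑ i, d i) * A.det := by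
  simp only [Matrix.det_apply]
  rw [Finset.sum_comm, Finset.mul_sum]
  refine Finset.sum_congr rfl fun σ _ => ?_
  rw [← Finset.smul_sum, mul_smul_comm, ← Equiv.sum_comp σ d, Finset.sum_mul]
  congr 1
  refine Finset.sum_congr rfl fun j _ => ?_
  rw [← Finset.mul_prod_erase _ _ (Finset.mem_univ j),
    ← Finset.mul_prod_erase _ _ (Finset.mem_univ j), Matrix.updateCol_self, mul_assoc]
  congr 2
  refine Finset.prod_congr rfl fun i hi => ?_
  rw [Matrix.updateCol_ne (Finset.ne_of_mem_erase hi)]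

/-- The two identities are proved together because each induction step uses both. -/
theorem hermiteH_succ_and_derivative (n : ℕ) :
    hermiteH (n + 1) = 2 * X * hermiteH n - derivative (hermiteH n) ∧
      derivative (hermiteH (n + 1)) = 2 * ((n : ℂ[X]) + 1) * hermiteH n := by
  induction n with
  | zero => simp [hermiteH]
  | succ n ih =>
    have h : hermiteH (n + 1 + 1) = 2 * X * hermiteH (n + 1) - derivative (hermiteH (n + 1)) := by
      rw [hermiteH, ih.2]
    refine ⟨h, ?_⟩
    have e : derivative (hermiteH (n + 1 + 1)) = 2 * hermiteH (n + 1)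
        + 2 * X * derivative (hermiteH (n + 1)) - 2 * ((n : ℂ[X]) + 1) * derivative (hermiteH n) := by
      rw [hermiteH]
      simp only [derivative_sub, derivative_mul, derivative_X, derivative_ofNat, derivative_add,
        derivative_one, derivative_natCast]
      ring
    rw [e, ih.2]
    push_cast
    linear_combination (2 * ((n : ℂ[X]) + 1)) * -ih.1

theorem hermiteH_succ (n : ℕ) :
    hermiteH (n + 1) = 2 * X * hermiteH n - derivative (hermiteH n) :=
  (hermiteH_succ_and_derivative n).1

theorem derivative_hermiteH_succ (n : ℕ) :
    derivative (hermiteH (n + 1)) = 2 * ((n : ℂ[X]) + 1) * hermiteH n :=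
  (hermiteH_succ_and_derivative n).2

/-- Hermite's equation `y'' = 2xy' - 2ty`, differentiated `j` times. -/
theorem iterate_derivative_hermiteH (t j : ℕ) :
    derivative^[j + 2] (hermiteH t) = 2 * X * derivative^[j + 1] (hermiteH t)
      + (2 * (j : ℂ[X]) - 2 * (t : ℂ[X])) * derivative^[j] (hermiteH t) := by
  induction j with
  | zero =>
    have h := congrArg derivative (hermiteH_succ t)
    rw [derivative_hermiteH_succ] at h
    simp only [derivative_sub, derivative_mul, derivative_X, derivative_ofNat] at h
    simp only [Function.iterate_succ_apply', Function.iterate_zero, id_eq, zero_add]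
    push_cast
    linear_combination h
  | succ j ih =>
    rw [Function.iterate_succ_apply', ih]
    simp only [Function.iterate_succ_apply', derivative_sub, derivative_mul, derivative_X,
      derivative_ofNat, derivative_add, derivative_natCast] at ih ⊢
    push_cast
    linear_combination 2 * X * ih

/-- The differential equations of the Hermite polynomials, summed over the columns of their
Wronskian. -/
theorem sum_derivMinor_add_two {n : ℕ} (t : Fin n → ℕ) :
    ∑ j : Fin n, derivMinor (fun i => hermiteH (t i))
        (Function.update (fun i : Fin n => (i : ℕ)) j (j + 2)) =
      2 * X * derivative (hermiteWronskian t)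
        + ((∑ j : Fin n, 2 * ((j : ℕ) : ℂ[X])) - ∑ i, 2 * (t i : ℂ[X])) * hermiteWronskian t := by
  have key (j : Fin n) : derivMinor (fun i => hermiteH (t i))
        (Function.update (fun i : Fin n => (i : ℕ)) j (j + 2)) =
      2 * X * derivMinor (fun i => hermiteH (t i))
        (Function.update (fun i : Fin n => (i : ℕ)) j (j + 1))
      + 2 * ((j : ℕ) : ℂ[X]) * hermiteWronskian t
      + ((Matrix.of fun i j : Fin n => derivative^[j] (hermiteH (t i))).updateCol j fun i =>
          (-(2 * (t i : ℂ[X]))) *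
          (Matrix.of fun i j : Fin n => derivative^[j] (hermiteH (t i))) i j).det := by
    rw [derivMinor_update, derivMinor_update]
    -- Hermite's equation splits this column into three; the eigenvalue `-2 t i` depends on the row,
    -- so the last one is not a multiple of an old column and is summed by `sum_det_updateCol_mul`.
    have e : (fun i => derivative^[(j : ℕ) + 2] (hermiteH (t i))) =
        (2 * X : ℂ[X]) • (fun i => derivative^[(j : ℕ) + 1] (hermiteH (t i)))
        + (2 * ((j : ℕ) : ℂ[X])) • (fun i => derivative^[(j : ℕ)] (hermiteH (t i)))
        + fun i => (-(2 * (t i : ℂ[X]))) *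
          (Matrix.of fun i j : Fin n => derivative^[j] (hermiteH (t i))) i j := by
      funext i
      simp only [iterate_derivative_hermiteH, Pi.add_apply, Pi.smul_apply, smul_eq_mul,
        Matrix.of_apply]
      ring
    rw [e, Matrix.det_updateCol_add, Matrix.det_updateCol_add, Matrix.det_updateCol_smul,
      Matrix.det_updateCol_smul, ← derivMinor_update _ _ _ (j : ℕ), Function.update_eq_self]
    rfl
  rw [Finset.sum_congr rfl fun j _ => key j, Finset.sum_add_distrib, Finset.sum_add_distrib,
    sum_det_updateCol_mul, ← Finset.mul_sum, ← Finset.sum_mul]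
  rw [hermiteWronskian, derivative_derivMinor, Finset.sum_neg_distrib]
  simp only [derivMinor]
  ring

/-- Column indices `0, …, N, a, b`. -/
def tailCols (N a b : ℕ) : Fin (N + 2) → ℕ :=
  Fin.snoc (Fin.snoc (fun i : Fin N => (i : ℕ)) a : Fin (N + 1) → ℕ) b

theorem val_eq_tailCols (N : ℕ) : (fun i : Fin (N + 2) => (i : ℕ)) = tailCols N N (N + 1) := by
  funext i
  refine Fin.lastCases ?_ (fun i => ?_) i
  · simp [tailCols]
  · refine Fin.lastCases ?_ (fun i => ?_) i <;> simp [tailCols]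

/-- By `h`, raising one of the orders `0, …, N - 1` by `d` produces an order already present, so
that minor vanishes and only the last two columns contribute. -/
theorem sum_derivMinor_update_tailCols {N : ℕ} (f : Fin (N + 2) → ℂ[X]) (a b d : ℕ)
    (h : ∀ i < N, i + d < N ∨ i + d = a ∨ i + d = b) (hd : d ≠ 0) :
    ∑ j, derivMinor f (Function.update (tailCols N a b) j (tailCols N a b j + d)) =
      derivMinor f (tailCols N (a + d) b) + derivMinor f (tailCols N a (b + d)) := by
  rw [Fin.sum_univ_castSucc, Fin.sum_univ_castSucc, Finset.sum_eq_zero, zero_add]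
  · congr 2
    · funext i
      refine Fin.lastCases ?_ (fun i => ?_) i
      · rw [Function.update_of_ne (by simp [Fin.ext_iff])]
        simp [tailCols]
      · refine Fin.lastCases ?_ (fun i => ?_) i
        · simp [tailCols]
        · rw [Function.update_of_ne (by simp [Fin.ext_iff]; omega)]
          simp [tailCols]
    · funext i
      refine Fin.lastCases ?_ (fun i => ?_) i
      · simp [tailCols]
      · rw [Function.update_of_ne (by simp [Fin.ext_iff]; omega)]
        simp [tailCols]
  · intro i _
    have hi : tailCols N a b i.castSucc.castSucc = i := by simp [tailCols]
    have aux (k : Fin (N + 2)) (hk : k ≠ i.castSucc.castSucc) (hv : tailCols N a b k = i + d) :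
        derivMinor f (Function.update (tailCols N a b) i.castSucc.castSucc
          (tailCols N a b i.castSucc.castSucc + d)) = 0 :=
      derivMinor_eq_zero f hk (by rw [Function.update_of_ne hk, Function.update_self, hv, hi])
    rcases h i i.2 with h | h | h
    · exact aux (Fin.castSucc (Fin.castSucc ⟨i + d, h⟩)) (by simp [Fin.ext_iff, hd])
        (by simp [tailCols, Fin.snoc, h, h.not_gt])
    · exact aux (Fin.last N).castSucc (by simp [Fin.ext_iff]; omega) (by simp [tailCols, h])
    · exact aux (Fin.last (N + 1)) (by simp [Fin.ext_iff]; omega) (by simp [tailCols, h])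

theorem derivMinor_tailCols_swap {N : ℕ} (f : Fin (N + 2) → ℂ[X]) (a b : ℕ) :
    derivMinor f (tailCols N a b) = -derivMinor f (tailCols N b a) := by
  rw [← derivMinor_swap f (tailCols N b a) (i := Fin.last _) (j := (Fin.last N).castSucc)
    (by simp [Fin.ext_iff])]
  congr 1
  funext i
  refine Fin.lastCases ?_ (fun i => ?_) i
  · simp [tailCols]
  · refine Fin.lastCases ?_ (fun i => ?_) i
    · simp [tailCols]
    · rw [Function.comp_apply, Equiv.swap_apply_of_ne_of_ne (by simp [Fin.ext_iff]; omega)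
        (by simp [Fin.ext_iff]; omega)]
      simp [tailCols]

theorem derivative_hermiteWronskian {N : ℕ} (t : Fin (N + 2) → ℕ) :
    derivative (hermiteWronskian t) =
      derivMinor (fun i => hermiteH (t i)) (tailCols N N (N + 2)) := by
  rw [hermiteWronskian, val_eq_tailCols, derivative_derivMinor,
    sum_derivMinor_update_tailCols _ _ _ _ (by omega) Nat.one_ne_zero, derivMinor_eq_zero _
      (i := (Fin.last N).castSucc) (j := Fin.last _) (by simp [Fin.ext_iff]) (by simp [tailCols]),
    zero_add]

theorem derivative_derivative_hermiteWronskian {N : ℕ} (t : Fin (N + 2) → ℕ) :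
    derivative (derivative (hermiteWronskian t)) =
      derivMinor (fun i => hermiteH (t i)) (tailCols N (N + 1) (N + 2)) +
      derivMinor (fun i => hermiteH (t i)) (tailCols N N (N + 3)) := by
  rw [derivative_hermiteWronskian, derivative_derivMinor,
    sum_derivMinor_update_tailCols _ _ _ _ (by omega) Nat.one_ne_zero, add_assoc N 2 1]

/-- Raising a column by two leaves the orders `(N + 2, N + 1)` and `(N, N + 3)` at the end; sorting
the first pair gives the minus sign. The second derivative is the sum of the same two minors. -/
theorem hermiteWronskian_ode {N : ℕ} (t : Fin (N + 2) → ℕ) :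
    derivMinor (fun i => hermiteH (t i)) (tailCols N N (N + 3)) -
      derivMinor (fun i => hermiteH (t i)) (tailCols N (N + 1) (N + 2)) =
    2 * X * derivative (hermiteWronskian t)
      + (((N : ℂ[X]) + 2) * ((N : ℂ[X]) + 1) - ∑ i, 2 * (t i : ℂ[X])) * hermiteWronskian t := by
  have h := sum_derivMinor_add_two t
  have e : ∀ j : Fin (N + 2), (j : ℕ) = tailCols N N (N + 1) j := congrFun (val_eq_tailCols N)
  rw [val_eq_tailCols] at h
  simp only [e] at h
  rw [sum_derivMinor_update_tailCols _ _ _ _ (by omega) two_ne_zero,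
    derivMinor_tailCols_swap _ (N + 2)] at h
  simp only [← e] at h
  have hs : ∑ j : Fin (N + 2), 2 * ((j : ℕ) : ℂ[X]) = ((N : ℂ[X]) + 2) * ((N : ℂ[X]) + 1) := by
    have := congrArg (Nat.cast : ℕ → ℂ[X]) (Finset.sum_range_id_mul_two (N + 2))
    rw [← Finset.mul_sum, Fin.sum_univ_eq_sum_range (fun i => (i : ℂ[X])), mul_comm]
    simpa [add_assoc] using this
  rw [hs] at h
  linear_combination h

/-- Cofactor expansion along the last column; the cofactors do not involve `b`, so the `0` used for
it in `A` is a placeholder. -/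
theorem derivMinor_tailCols_eq_sum {N : ℕ} (f : Fin (N + 2) → ℂ[X]) (a : ℕ) :
    ∃ v : Fin (N + 2) → ℂ[X], ∀ b,
      derivMinor f (tailCols N a b) = ∑ i, v i * derivative^[b] (f i) := by
  let A : Matrix (Fin (N + 2)) (Fin (N + 2)) ℂ[X] :=
    Matrix.of fun i j => derivative^[tailCols N a 0 j] (f i)
  refine ⟨fun i => A.adjugate (Fin.last _) i, fun b => ?_⟩
  have e : tailCols N a b = Function.update (tailCols N a 0) (Fin.last _) b := by
    simp only [tailCols, Fin.update_snoc_last]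
  rw [e, derivMinor_update, ← Matrix.cramer_apply, Matrix.cramer_eq_adjugate_mulVec]
  rfl

/-- A three-term Plücker relation between the minors of `f` and those of `g, f`. -/
theorem derivMinor_plucker {N : ℕ} (f : Fin (N + 2) → ℂ[X]) (g : ℂ[X]) (F : Fin (N + 3) → ℂ[X])
    (hF : F = Fin.cons g f) :
    derivMinor f (tailCols N N (N + 1)) * derivMinor F (tailCols (N + 1) (N + 2) (N + 3)) -
      derivMinor f (tailCols N N (N + 2)) * derivMinor F (tailCols (N + 1) (N + 1) (N + 3)) +
      derivMinor f (tailCols N N (N + 3)) * derivMinor F (tailCols (N + 1) (N + 1) (N + 2)) = 0 := by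
  obtain ⟨v, hv⟩ := derivMinor_tailCols_eq_sum f N
  -- The top row is a combination of the rows of `f`, so `B` is singular. Expanding along it, the
  -- entries `j ≤ N` vanish by a repeated column, and the remaining three give the relation.
  let B : Matrix (Fin (N + 4)) (Fin (N + 4)) ℂ[X] := Matrix.of fun i j =>
    (Fin.cons (derivMinor f (tailCols N N j)) (fun i => derivative^[j] (F i)) :
      Fin (N + 4) → ℂ[X]) i
  have hB : B.det = 0 := by
    rw [← Matrix.exists_vecMul_eq_zero_iff]
    refine ⟨Fin.cons (-1) (Fin.cons 0 v), fun h => ?_, ?_⟩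
    · simpa using congrFun h 0
    · funext j
      simp only [Matrix.vecMul, dotProduct]
      rw [Fin.sum_univ_succ, Fin.sum_univ_succ]
      simp [B, hF, hv]
  rw [Matrix.det_succ_row_zero, Fin.sum_univ_castSucc, Fin.sum_univ_castSucc,
    Fin.sum_univ_castSucc, Finset.sum_eq_zero, zero_add] at hB
  · have hsub (j : Fin (N + 4)) : (B.submatrix Fin.succ j.succAbove).det =
        derivMinor F fun i => (j.succAbove i : ℕ) := by
      rfl
    have h1 : (fun i => ((Fin.last (N + 3)).succAbove i : ℕ)) =
        tailCols (N + 1) (N + 1) (N + 2) := by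
      rw [← val_eq_tailCols]
      simp
    have h2 : (fun i => ((Fin.last (N + 2)).castSucc.succAbove i : ℕ)) =
        tailCols (N + 1) (N + 1) (N + 3) := by
      funext i
      refine Fin.lastCases ?_ (fun i => ?_) i
      · simp [tailCols]
      · rw [Fin.succAbove_of_castSucc_lt _ _ (by simp [Fin.lt_def])]
        refine Fin.lastCases ?_ (fun i => ?_) i <;> simp [tailCols]
    have h3 : (fun i => ((Fin.last (N + 1)).castSucc.castSucc.succAbove i : ℕ)) =
        tailCols (N + 1) (N + 2) (N + 3) := by
      funext i
      refine Fin.lastCases ?_ (fun i => ?_) i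
      · rw [Fin.succAbove_of_le_castSucc _ _ (Fin.castSucc_le_castSucc_iff.2 (Fin.le_last _))]
        simp [tailCols]
      · refine Fin.lastCases ?_ (fun i => ?_) i
        · rw [Fin.succAbove_of_le_castSucc _ _ (by simp)]
          simp [tailCols]
        · rw [Fin.succAbove_of_castSucc_lt _ _ (by simp [Fin.lt_def]; omega)]
          simp [tailCols]
    rw [hsub, hsub, hsub, h1, h2, h3] at hB
    simp only [B, Matrix.of_apply, Fin.cons_zero, Fin.val_castSucc, Fin.val_last] at hB
    have hs : ((-1 : ℂ[X]) ^ (N + 1)) * (-1) ^ (N + 1) = 1 := by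
      rw [← mul_pow]; simp
    linear_combination ((-1) ^ (N + 1)) * hB + (-derivMinor f (tailCols N N (N + 1)) *
        derivMinor F (tailCols (N + 1) (N + 2) (N + 3)) +
      derivMinor f (tailCols N N (N + 2)) * derivMinor F (tailCols (N + 1) (N + 1) (N + 3)) -
      derivMinor f (tailCols N N (N + 3)) * derivMinor F (tailCols (N + 1) (N + 1) (N + 2))) * hs
  · intro i _
    have : derivMinor f (tailCols N N (i : ℕ)) = 0 := by
      rcases Fin.eq_castSucc_or_eq_last i with ⟨k, rfl⟩ | rfl
      · exact derivMinor_eq_zero f (i := k.castSucc.castSucc) (j := Fin.last _)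
          (by simp [Fin.ext_iff]; omega) (by simp [tailCols])
      · exact derivMinor_eq_zero f (i := (Fin.last N).castSucc) (j := Fin.last _)
          (by simp [Fin.ext_iff]) (by simp [tailCols])
    simp [B, this]

/-- The Hirota bilinear equation relating the Wronskians of `H_{t_1}, …, H_{t_n}` and
`H_m, H_{t_1}, …, H_{t_n}`. -/
theorem hermiteWronskian_bilinear {n : ℕ} (hn : 2 ≤ n) (t : Fin n → ℕ) (m : ℕ) (P Q : ℂ[X])
    (hP : P = hermiteWronskian t) (hQ : Q = hermiteWronskian (Fin.cons m t : Fin (n + 1) → ℕ)) :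
    derivative (derivative Q) * P - 2 * derivative Q * derivative P
      + Q * derivative (derivative P) - 2 * X * (derivative Q * P - derivative P * Q)
      + 2 * ((m : ℂ[X]) - (n : ℂ[X])) * (P * Q) = 0 := by
  obtain ⟨N, rfl⟩ : ∃ N, n = N + 2 := ⟨n - 2, by omega⟩
  have hF : (fun i => hermiteH ((Fin.cons m t : Fin (N + 3) → ℕ) i)) =
      Fin.cons (hermiteH m) fun i => hermiteH (t i) := by
    funext i
    refine Fin.cases ?_ (fun i => ?_) i <;> simp
  have h0 := derivMinor_plucker (fun i => hermiteH (t i)) (hermiteH m) _ hF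
  have p0 : P = derivMinor (fun i => hermiteH (t i)) (tailCols N N (N + 1)) := by
    rw [hP, hermiteWronskian, val_eq_tailCols]
  have q0 : Q = derivMinor (fun i => hermiteH ((Fin.cons m t : Fin (N + 3) → ℕ) i))
      (tailCols (N + 1) (N + 1) (N + 2)) := by
    rw [hQ, hermiteWronskian, val_eq_tailCols]
  have p1 := derivative_hermiteWronskian t
  have q1 := derivative_hermiteWronskian (N := N + 1) (Fin.cons m t : Fin (N + 3) → ℕ)
  have p2 := derivative_derivative_hermiteWronskian t
  have q2 := derivative_derivative_hermiteWronskian (N := N + 1) (Fin.cons m t : Fin (N + 3) → ℕ)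
  have p3 := hermiteWronskian_ode t
  have q3 := hermiteWronskian_ode (N := N + 1) (Fin.cons m t : Fin (N + 3) → ℕ)
  rw [← hP] at p1 p2 p3
  rw [← hQ] at q1 q2 q3
  rw [Fin.sum_univ_succ] at q3
  simp only [Fin.cons_zero, Fin.cons_succ] at q3
  rw [← p0, ← q0, ← p1, ← q1] at h0
  push_cast at q3 ⊢
  -- Second derivatives are sums of two minors. Subtracting twice the Plücker relation turns these
  -- sums into the differences evaluated by `p3` and `q3`, whose constants differ by `2(n - m)`.
  linear_combination 2 * h0 + P * q2 + Q * p2 + P * q3 - Q * p3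

/-! ### Leading coefficients and non-vanishing of Hermite Wronskians. -/

theorem natDegree_hermiteH_le (n : ℕ) : (hermiteH n).natDegree ≤ n := by
  induction n with
  | zero => simp [hermiteH]
  | succ n ih =>
    rw [hermiteH_succ]
    refine (natDegree_sub_le _ _).trans (max_le ?_ ?_)
    · rw [mul_assoc]
      have h2 : (2 : ℂ[X]).natDegree = 0 := natDegree_ofNat 2
      have := natDegree_mul_le (p := (2 : ℂ[X])) (q := X * hermiteH n)
      have := natDegree_mul_le (p := (X : ℂ[X])) (q := hermiteH n)
      have := natDegree_X_le (R := ℂ)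
      omega
    · exact (natDegree_derivative_le _).trans (by omega)

theorem coeff_hermiteH_self (n : ℕ) : (hermiteH n).coeff n = 2 ^ n := by
  induction n with
  | zero => simp [hermiteH]
  | succ n ih =>
    have h : (derivative (hermiteH n)).coeff (n + 1) = 0 := by
      rw [coeff_derivative, coeff_eq_zero_of_natDegree_lt, zero_mul]
      exact (natDegree_hermiteH_le n).trans_lt (by omega)
    rw [hermiteH_succ, coeff_sub, h, mul_assoc, coeff_ofNat_mul, coeff_X_mul, ih]
    ring

theorem coeff_X_pow_mul_iterate_derivative (p : ℂ[X]) (j N : ℕ) :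
    (X ^ j * derivative^[j] p).coeff N = N.descFactorial j * p.coeff N := by
  rw [coeff_X_pow_mul']
  split_ifs with h
  · rw [coeff_iterate_derivative, Nat.sub_add_cancel h, nsmul_eq_mul]
  · rw [Nat.descFactorial_of_lt (not_le.1 h)]
    simp

theorem coeff_prod_of_natDegree_le_sum {ι : Type*} (s : Finset ι) (f : ι → ℂ[X]) (d : ι → ℕ)
    (h : ∀ i, (f i).natDegree ≤ d i) :
    (∏ i ∈ s, f i).coeff (∑ i ∈ s, d i) = ∏ i ∈ s, (f i).coeff (d i) := by
  classical
  induction s using Finset.induction_on with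
  | empty => simp
  | insert a s ha ih =>
    rw [Finset.prod_insert ha, Finset.sum_insert ha, Finset.prod_insert ha,
      coeff_mul_add_eq_of_natDegree_le (h a), ih]
    exact (natDegree_prod_le _ _).trans (Finset.sum_le_sum fun i _ => h i)

/-- After multiplying column `j` by `X ^ j`, row `i` has degree at most `t i`. The coefficient of
degree `∑ t i` is then, up to powers of two, a determinant of falling factorials of the `t i`, that
is, a Vandermonde determinant. -/
theorem hermiteWronskian_ne_zero {n : ℕ} (t : Fin n → ℕ) (ht : Function.Injective t) :
    hermiteWronskian t ≠ 0 := by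
  intro h0
  let e : Matrix (Fin n) (Fin n) ℂ[X] :=
    Matrix.of fun i j => X ^ (j : ℕ) * derivative^[j] (hermiteH (t i))
  have he : e.det = 0 := by
    have := Matrix.det_mul_row (fun j : Fin n => (X : ℂ[X]) ^ (j : ℕ))
      (Matrix.of fun i j : Fin n => derivative^[j] (hermiteH (t i)))
    refine this.trans ?_
    rw [show (Matrix.of fun i j : Fin n => derivative^[j] (hermiteH (t i))).det = 0 from h0,
      mul_zero]
  have hdeg (i j : Fin n) : (e i j).natDegree ≤ t i := by
    rw [natDegree_le_iff_coeff_eq_zero]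
    intro N hN
    simp only [e, Matrix.of_apply]
    rw [coeff_X_pow_mul_iterate_derivative, coeff_eq_zero_of_natDegree_lt,
      mul_zero]
    exact (natDegree_hermiteH_le _).trans_lt hN
  have hc : e.det.coeff (∑ i, t i) =
      (Matrix.of fun i j : Fin n =>
        (2 : ℂ) ^ t i * (descPochhammer ℂ (j : ℕ)).eval (t i : ℂ)).det := by
    rw [Matrix.det_apply, Matrix.det_apply, finsetSum_coeff]
    refine Finset.sum_congr rfl fun σ _ => ?_
    rw [Units.smul_def, coeff_smul, Units.smul_def, ← Equiv.sum_comp σ t,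
      coeff_prod_of_natDegree_le_sum _ _ (fun i => t (σ i)) fun i => hdeg _ _]
    congr 1
    refine Finset.prod_congr rfl fun j _ => ?_
    simp only [e, Matrix.of_apply]
    rw [coeff_X_pow_mul_iterate_derivative,
      coeff_hermiteH_self, descPochhammer_eval_eq_descFactorial, mul_comm]
  have hd := Matrix.det_mul_column (fun i : Fin n => (2 : ℂ) ^ t i)
    (Matrix.of fun i j : Fin n => (descPochhammer ℂ (j : ℕ)).eval (t i : ℂ))
  simp only [Matrix.of_apply] at hd
  rw [← Matrix.det_eval_matrixOfPolynomials_eq_det_vandermonde (fun i => (t i : ℂ))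
    (fun j : Fin n => descPochhammer ℂ (j : ℕ)) (fun i => descPochhammer_natDegree ℂ i)
    (fun i => monic_descPochhammer ℂ i)] at hd
  rw [he, coeff_zero, hd, eq_comm, mul_eq_zero] at hc
  rcases hc with hc | hc
  · exact Finset.prod_ne_zero_iff.2 (fun i _ => pow_ne_zero _ two_ne_zero) hc
  · exact Matrix.det_vandermonde_ne_zero_iff.2 (fun i j hij => ht (by exact_mod_cast hij)) hc

end Minors

/-! ### Wronskians of lists of functions, up to a non-zero constant. -/

theorem exists_equiv_get_of_perm {ι : Type*} {L L' : List ι} (h : L.Perm L') :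
    ∃ σ : Fin L.length ≃ Fin L'.length, ∀ i, L.get i = L'.get (σ i) := by
  induction h with
  | nil => exact ⟨Equiv.refl _, fun _ => rfl⟩
  | cons a _ ih =>
    obtain ⟨σ, hσ⟩ := ih
    refine ⟨(finSuccEquiv _).trans ((Equiv.optionCongr σ).trans (finSuccEquiv _).symm), ?_⟩
    refine Fin.cases ?_ fun i => ?_
    · simp
    · simpa using hσ i
  | swap a b l =>
    refine ⟨Equiv.swap 0 1, ?_⟩
    refine Fin.cases ?_ (Fin.cases ?_ fun i => ?_)
    · simp
    · simp
    · rw [Equiv.swap_apply_of_ne_of_ne (by simp [Fin.ext_iff]) (by simp [Fin.ext_iff])]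
      rfl
  | trans _ _ ih₁ ih₂ =>
    obtain ⟨σ, hσ⟩ := ih₁
    obtain ⟨τ, hτ⟩ := ih₂
    exact ⟨σ.trans τ, fun i => by rw [hσ, hτ]; rfl⟩

section Wronskian

variable {ι κ : Type*}

/-- Leibniz's rule is multiplication on the right by the upper triangular matrix `T`, whose diagonal
entries all equal `g z`. -/
theorem wronskianDet_mul {n : ℕ} (g : ℂ → ℂ) (f : Fin n → ℂ → ℂ) (hg : ContDiff ℂ ⊤ g)
    (hf : ∀ i, ContDiff ℂ ⊤ (f i)) (z : ℂ) :
    wronskianDet (fun i x => g x * f i x) z = g z ^ n * wronskianDet f z := by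
  let T : Matrix (Fin n) (Fin n) ℂ :=
    Matrix.of fun l j => (j : ℕ).choose l * iteratedDeriv ((j : ℕ) - l) g z
  have hT : T.det = g z ^ n := by
    rw [Matrix.det_of_isUpperTriangular]
    · simp [T]
    · intro i j hij
      simp only [T, Matrix.of_apply]
      rw [Nat.choose_eq_zero_of_lt (by exact hij)]
      simp
  rw [mul_comm, ← hT, wronskianDet, wronskianDet, ← Matrix.det_mul]
  congr 1
  ext1 i j
  simp only [T, Matrix.of_apply, Matrix.mul_apply]
  have e : (fun x => g x * f i x) = f i * g := by
    funext x
    simp [mul_comm]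
  rw [e, iteratedDeriv_mul ((hf i).contDiffAt.of_le le_top) (hg.contDiffAt.of_le le_top),
    Fin.sum_univ_eq_sum_range
      (fun l => iteratedDeriv l (f i) z * ((j : ℕ).choose l * iteratedDeriv ((j : ℕ) - l) g z)) n]
  refine (Finset.sum_congr rfl fun l _ => by ring).trans (Finset.sum_subset ?_ fun l _ hl => ?_)
  · exact Finset.range_mono j.2
  · rw [Nat.choose_eq_zero_of_lt (by simpa using hl)]
    simp

theorem wronskianDet_const_mul {n : ℕ} (c : Fin n → ℂ) (f : Fin n → ℂ → ℂ) (z : ℂ) :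
    wronskianDet (fun i x => c i * f i x) z = (∏ i, c i) * wronskianDet f z := by
  rw [wronskianDet, wronskianDet, ← Matrix.det_mul_column]
  congr 1
  ext1 i j
  simp [iteratedDeriv_const_mul_field]

theorem wronskianDet_of_zero_eq_one {n : ℕ} (f : Fin (n + 1) → ℂ → ℂ) (h : f 0 = fun _ => 1)
    (z : ℂ) : wronskianDet f z = wronskianDet (fun i => deriv (f i.succ)) z := by
  rw [wronskianDet, Matrix.det_succ_row_zero, Fin.sum_univ_succ, Finset.sum_eq_zero, add_zero]
  · simp only [Matrix.of_apply, h, wronskianDet, Fin.val_zero, iteratedDeriv_zero, pow_zero,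
      mul_one, one_mul]
    congr 1
    ext1 i j
    simp [iteratedDeriv_succ']
  · intro j _
    simp [h, iteratedDeriv_const]

theorem wronskianDet_comp_cast {n m : ℕ} (h : n = m) (f : Fin n → ℂ → ℂ) (g : Fin m → ℂ → ℂ)
    (hfg : ∀ i, f i = g (Fin.cast h i)) : wronskianDet f = wronskianDet g := by
  subst h
  congr 1
  funext i
  exact hfg i

/-- `f` is a non-zero constant multiple of `g`. -/
def IsScalarMultiple (f g : ℂ → ℂ) : Prop := ∃ c : ℂ, c ≠ 0 ∧ ∀ z, f z = c * g z

theorem IsScalarMultiple.refl (f : ℂ → ℂ) : IsScalarMultiple f f := ⟨1, one_ne_zero, by simp⟩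

theorem IsScalarMultiple.symm {f g : ℂ → ℂ} (h : IsScalarMultiple f g) :
    IsScalarMultiple g f := by
  obtain ⟨c, hc, h⟩ := h
  exact ⟨c⁻¹, inv_ne_zero hc, fun z => by rw [h, inv_mul_cancel_left₀ hc]⟩

theorem IsScalarMultiple.trans {f g h : ℂ → ℂ} (h₁ : IsScalarMultiple f g)
    (h₂ : IsScalarMultiple g h) : IsScalarMultiple f h := by
  obtain ⟨c, hc, h₁⟩ := h₁
  obtain ⟨d, hd, h₂⟩ := h₂
  exact ⟨c * d, mul_ne_zero hc hd, fun z => by rw [h₁, h₂, mul_assoc]⟩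

theorem IsScalarMultiple.mul_left {f g : ℂ → ℂ} (h : IsScalarMultiple f g) (u : ℂ → ℂ) :
    IsScalarMultiple (fun z => u z * f z) fun z => u z * g z := by
  obtain ⟨c, hc, h⟩ := h
  exact ⟨c, hc, fun z => by simp only [h]; ring⟩

/-- The Wronskian of the members of a family `φ` indexed by the entries of a list. -/
noncomputable def listWronskian (φ : ι → ℂ → ℂ) (L : List ι) : ℂ → ℂ :=
  wronskianDet fun i : Fin L.length => φ (L.get i)

theorem listWronskian_ofFn (φ : ι → ℂ → ℂ) {n : ℕ} (f : Fin n → ι) :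
    listWronskian φ (List.ofFn f) = wronskianDet fun i => φ (f i) :=
  wronskianDet_comp_cast (by simp) _ _ fun i => by simp; rfl

theorem listWronskian_map (φ : ι → ℂ → ℂ) (g : κ → ι) (L : List κ) :
    listWronskian φ (L.map g) = listWronskian (fun i => φ (g i)) L :=
  wronskianDet_comp_cast (by simp) _ _ fun i => by simp

theorem listWronskian_perm (φ : ι → ℂ → ℂ) {L L' : List ι} (h : L.Perm L') :
    IsScalarMultiple (listWronskian φ L) (listWronskian φ L') := by
  obtain ⟨σ, hσ⟩ := exists_equiv_get_of_perm h
  let τ : Equiv.Perm (Fin L'.length) := (finCongr h.length_eq.symm).trans σ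
  refine ⟨(Equiv.Perm.sign τ : ℤ), by simp, fun z => ?_⟩
  rw [listWronskian, wronskianDet_comp_cast h.length_eq _ (fun i => φ (L'.get (τ i)))
    (fun i => by rw [hσ]; rfl), wronskianDet]
  exact Matrix.det_permute τ
    (Matrix.of fun i j : Fin L'.length => iteratedDeriv (j : ℕ) (φ (L'.get i)) z)

theorem listWronskian_mul (g : ℂ → ℂ) (φ : ι → ℂ → ℂ) (L : List ι) (hg : ContDiff ℂ ⊤ g)
    (hφ : ∀ i, ContDiff ℂ ⊤ (φ i)) (z : ℂ) :
    listWronskian (fun i x => g x * φ i x) L z = g z ^ L.length * listWronskian φ L z :=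
  wronskianDet_mul g _ hg (fun _ => hφ _) z

theorem listWronskian_const_mul (c : ι → ℂ) (hc : ∀ i, c i ≠ 0) (φ : ι → ℂ → ℂ) (L : List ι) :
    IsScalarMultiple (listWronskian (fun i x => c i * φ i x) L) (listWronskian φ L) :=
  ⟨_, Finset.prod_ne_zero_iff.2 fun i _ => hc (L.get i), wronskianDet_const_mul _ _⟩

theorem listWronskian_cons_one (φ : ι → ℂ → ℂ) (a : ι) (L : List ι) (h : φ a = fun _ => 1) :
    listWronskian φ (a :: L) = listWronskian (fun i => deriv (φ i)) L :=
  funext fun z => wronskianDet_of_zero_eq_one _ h z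

end Wronskian

/-! ### Frobenius symbols as lists, and the charge. -/

section Frobenius

/-- The entries of the Hermite pseudo-Wronskian, indexed by the Frobenius symbol. -/
noncomputable def frobeniusEntry : ℕ ⊕ ℕ → ℂ → ℂ :=
  Sum.elim (fun s x => Complex.exp (x ^ 2) * (conjHermiteH s).eval x) fun t x => (hermiteH t).eval x

/-- The list `L` enumerates the Frobenius symbol of `M`. -/
structure IsFrobeniusList (M : MayaDiagram) (L : List (ℕ ⊕ ℕ)) : Prop where
  nodup : L.Nodup
  mem_inl : ∀ s : ℕ, Sum.inl s ∈ L ↔ -(s : ℤ) - 1 ∉ M.carrier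
  mem_inr : ∀ t : ℕ, Sum.inr t ∈ L ↔ (t : ℤ) ∈ M.carrier

theorem IsFrobeniusList.perm {M : MayaDiagram} {L L' : List (ℕ ⊕ ℕ)} (h : IsFrobeniusList M L)
    (h' : IsFrobeniusList M L') : L.Perm L' := by
  rw [List.perm_ext_iff_of_nodup h.nodup h'.nodup]
  rintro (s | t)
  · rw [h.mem_inl, h'.mem_inl]
  · rw [h.mem_inr, h'.mem_inr]

/-- The number of particles minus the number of holes. -/
noncomputable def MayaDiagram.charge (M : MayaDiagram) : ℤ := M.plus.card - M.minus.card

theorem MayaDiagram.mem_plus (M : MayaDiagram) (t : ℕ) : t ∈ M.plus ↔ (t : ℤ) ∈ M.carrier := by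
  simp [MayaDiagram.plus]

theorem MayaDiagram.mem_minus (M : MayaDiagram) (s : ℕ) :
    s ∈ M.minus ↔ -(s : ℤ) - 1 ∉ M.carrier := by
  simp [MayaDiagram.minus]

/-- The Frobenius symbol of `M` in the order used by `pseudoWronskian`. -/
noncomputable def frobeniusList (M : MayaDiagram) : List (ℕ ⊕ ℕ) :=
  List.ofFn (Fin.append
    (fun i : Fin M.minus.card => (Sum.inl (M.minus.orderEmbOfFin rfl i.rev) : ℕ ⊕ ℕ))
    (fun j : Fin M.plus.card => (Sum.inr (M.plus.orderEmbOfFin rfl j) : ℕ ⊕ ℕ)))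

theorem frobeniusList_eq (M : MayaDiagram) : frobeniusList M =
    List.ofFn (fun i : Fin M.minus.card => (Sum.inl (M.minus.orderEmbOfFin rfl i.rev) : ℕ ⊕ ℕ)) ++
    List.ofFn (fun j : Fin M.plus.card => (Sum.inr (M.plus.orderEmbOfFin rfl j) : ℕ ⊕ ℕ)) :=
  List.ofFn_fin_append _ _

theorem exists_orderEmbOfFin_eq_iff (S : Finset ℕ) (t : ℕ) :
    (∃ i, S.orderEmbOfFin rfl i = t) ↔ t ∈ S := by
  rw [← Finset.mem_coe, ← Finset.range_orderEmbOfFin S rfl, Set.mem_range]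

theorem isFrobeniusList_frobeniusList (M : MayaDiagram) :
    IsFrobeniusList M (frobeniusList M) := by
  rw [frobeniusList_eq]
  refine ⟨?_, fun s => ?_, fun t => ?_⟩
  · rw [List.nodup_append, List.nodup_ofFn, List.nodup_ofFn]
    refine ⟨fun i j h => ?_, fun i j h => ?_, ?_⟩
    · simpa using h
    · simpa using h
    · simp only [List.mem_ofFn]
      rintro _ ⟨i, rfl⟩ _ ⟨j, rfl⟩
      simp
  · rw [← M.mem_minus, ← exists_orderEmbOfFin_eq_iff]
    simpa [List.mem_ofFn] using
      (Fin.rev_surjective.exists (p := fun i => M.minus.orderEmbOfFin rfl i = s)).symm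
  · rw [← M.mem_plus, ← exists_orderEmbOfFin_eq_iff]
    simp [List.mem_ofFn]

theorem countP_isLeft_frobeniusList (M : MayaDiagram) :
    (frobeniusList M).countP Sum.isLeft = M.minus.card := by
  rw [frobeniusList_eq, List.countP_append, List.countP_eq_length.2, List.countP_eq_zero.2]
  · simp
  · simp only [List.mem_ofFn]
    rintro _ ⟨i, rfl⟩
    simp
  · simp only [List.mem_ofFn]
    rintro _ ⟨i, rfl⟩
    simp

theorem IsFrobeniusList.countP_isLeft {M : MayaDiagram} {L : List (ℕ ⊕ ℕ)}
    (h : IsFrobeniusList M L) : L.countP Sum.isLeft = M.minus.card := by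
  rw [← countP_isLeft_frobeniusList, (h.perm (isFrobeniusList_frobeniusList M)).countP_eq]

theorem IsFrobeniusList.charge {M : MayaDiagram} {L : List (ℕ ⊕ ℕ)}
    (h : IsFrobeniusList M L) : M.charge = L.length - 2 * L.countP Sum.isLeft := by
  have := (h.perm (isFrobeniusList_frobeniusList M)).length_eq
  rw [frobeniusList, List.length_ofFn] at this
  rw [this, h.countP_isLeft, MayaDiagram.charge]
  push_cast
  ring

/-- Reordering the entries only changes the sign, so any convenient enumeration of the Frobenius
symbol may be used. -/
theorem IsFrobeniusList.pseudoWronskian {M : MayaDiagram} {L : List (ℕ ⊕ ℕ)}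
    (h : IsFrobeniusList M L) : IsScalarMultiple (pseudoWronskian M) fun z =>
      Complex.exp (-(L.countP Sum.isLeft : ℂ) * z ^ 2) * listWronskian frobeniusEntry L z := by
  rw [h.countP_isLeft]
  refine IsScalarMultiple.trans ?_ (((isFrobeniusList_frobeniusList M).perm h |>
    listWronskian_perm frobeniusEntry).mul_left _)
  rw [frobeniusList, listWronskian_ofFn]
  convert IsScalarMultiple.refl _ using 1
  funext z
  rw [_root_.pseudoWronskian]
  congr 2
  funext i
  refine Fin.addCases (fun i => ?_) (fun i => ?_) i <;> simp [frobeniusEntry]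

end Frobenius

/-! ### Translation of a Maya diagram. -/

section Shift

open Polynomial

theorem conjHermiteH_succ (n : ℕ) : conjHermiteH (n + 1) =
    2 * X * conjHermiteH n + derivative (conjHermiteH n) := by
  have hI : (C Complex.I : ℂ[X]) * C Complex.I = -1 := by
    rw [← C_mul, Complex.I_mul_I, C_neg, C_1]
  have hp : (C ((Complex.I ^ (n + 1))⁻¹) : ℂ[X]) * C Complex.I = C ((Complex.I ^ n)⁻¹) := by
    rw [← C_mul, pow_succ, mul_inv, mul_assoc, inv_mul_cancel₀ Complex.I_ne_zero, mul_one]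
  have h2 : ((2 : ℂ[X]).comp (C Complex.I * X)) = 2 := by simp
  have hq : (C ((Complex.I ^ (n + 1))⁻¹) : ℂ[X]) = -(C ((Complex.I ^ n)⁻¹) * C Complex.I) := by
    rw [← hp, mul_assoc, hI]
    ring
  simp only [conjHermiteH, hermiteH_succ, sub_comp, mul_comp, X_comp, h2, derivative_mul,
    derivative_C, derivative_comp, derivative_X, zero_mul, zero_add, mul_one, hq]
  linear_combination (-(2 * C ((Complex.I ^ n)⁻¹) * X * (hermiteH n).comp (C Complex.I * X))) * hI

theorem derivative_conjHermiteH_succ (n : ℕ) : derivative (conjHermiteH (n + 1)) =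
    2 * ((n : ℂ[X]) + 1) * conjHermiteH n := by
  have hp : (C ((Complex.I ^ (n + 1))⁻¹) : ℂ[X]) * C Complex.I = C ((Complex.I ^ n)⁻¹) := by
    rw [← C_mul, pow_succ, mul_inv, mul_assoc, inv_mul_cancel₀ Complex.I_ne_zero, mul_one]
  have h2 : ((2 : ℂ[X]).comp (C Complex.I * X)) = 2 := by simp
  simp only [conjHermiteH, derivative_mul, derivative_C, derivative_comp, derivative_hermiteH_succ,
    derivative_X, zero_mul, zero_add, mul_one, mul_comp, add_comp, natCast_comp, one_comp, h2]
  linear_combination (2 * ((n : ℂ[X]) + 1) * (hermiteH n).comp (C Complex.I * X)) * hp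

theorem hasDerivAt_exp_sq (z : ℂ) : HasDerivAt (fun x : ℂ => Complex.exp (x ^ 2))
    (Complex.exp (z ^ 2) * (2 * z)) z := by
  simpa using (hasDerivAt_pow 2 z).cexp

theorem hasDerivAt_exp_neg_sq (z : ℂ) : HasDerivAt (fun x : ℂ => Complex.exp (-x ^ 2))
    (Complex.exp (-z ^ 2) * -(2 * z)) z := by
  simpa using (hasDerivAt_pow 2 z).neg.cexp

theorem contDiff_eval (p : ℂ[X]) : ContDiff ℂ ⊤ fun x => p.eval x := by
  simpa using p.contDiff_aeval (𝕜 := ℂ) ⊤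

theorem contDiff_frobeniusEntry (i : ℕ ⊕ ℕ) : ContDiff ℂ ⊤ (frobeniusEntry i) := by
  rcases i with s | t
  · exact (contDiff_id.pow 2).cexp.mul (contDiff_eval _)
  · exact contDiff_eval _

theorem frobeniusEntry_inr_zero : frobeniusEntry (Sum.inr 0) = fun _ => 1 := by
  simp [frobeniusEntry, hermiteH]

theorem deriv_frobeniusEntry_inl (s : ℕ) :
    deriv (frobeniusEntry (Sum.inl s)) = frobeniusEntry (Sum.inl (s + 1)) := by
  funext z
  refine ((hasDerivAt_exp_sq z).mul ((conjHermiteH s).hasDerivAt z)).deriv.trans ?_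
  simp [frobeniusEntry, conjHermiteH_succ]
  ring

theorem deriv_frobeniusEntry_inr_succ (t : ℕ) :
    deriv (frobeniusEntry (Sum.inr (t + 1))) =
      fun z => 2 * ((t : ℂ) + 1) * frobeniusEntry (Sum.inr t) z := by
  funext z
  refine ((hermiteH (t + 1)).hasDerivAt z).deriv.trans ?_
  simp [frobeniusEntry, derivative_hermiteH_succ]

theorem exp_neg_sq_mul_frobeniusEntry_inl (s : ℕ) (z : ℂ) :
    Complex.exp (-z ^ 2) * frobeniusEntry (Sum.inl s) z = (conjHermiteH s).eval z := by
  rw [frobeniusEntry, Sum.elim_inl, ← mul_assoc, ← Complex.exp_add]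
  simp

theorem deriv_exp_neg_sq_mul_frobeniusEntry_inl_succ (s : ℕ) (z : ℂ) :
    deriv (fun x => Complex.exp (-x ^ 2) * frobeniusEntry (Sum.inl (s + 1)) x) z =
      2 * ((s : ℂ) + 1) * (Complex.exp (-z ^ 2) * frobeniusEntry (Sum.inl s) z) := by
  simp only [exp_neg_sq_mul_frobeniusEntry_inl]
  rw [Polynomial.deriv, derivative_conjHermiteH_succ]
  simp

theorem deriv_exp_neg_sq_mul_frobeniusEntry_inr (t : ℕ) (z : ℂ) :
    deriv (fun x => Complex.exp (-x ^ 2) * frobeniusEntry (Sum.inr t) x) z =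
      -(Complex.exp (-z ^ 2) * frobeniusEntry (Sum.inr (t + 1)) z) := by
  refine ((hasDerivAt_exp_neg_sq z).mul ((hermiteH t).hasDerivAt z)).deriv.trans ?_
  simp [frobeniusEntry, hermiteH_succ]
  ring

/-- Since `H_0 = 1`, it can be dropped at the cost of differentiating the other entries, which
raises every `s` and lowers every `t`, up to constants. -/
theorem listWronskian_inr_zero_cons (L : List (ℕ ⊕ ℕ)) :
    IsScalarMultiple
      (listWronskian frobeniusEntry (Sum.inr 0 :: L.map (Sum.map id Nat.succ)))
      (listWronskian frobeniusEntry (L.map (Sum.map Nat.succ id))) := by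
  rw [listWronskian_cons_one _ _ _ frobeniusEntry_inr_zero, listWronskian_map, listWronskian_map]
  have e : (fun i => deriv (frobeniusEntry (Sum.map id Nat.succ i))) =
      fun (i : ℕ ⊕ ℕ) z => (Sum.elim (fun _ => 1) (fun t : ℕ => 2 * ((t : ℂ) + 1)) i) *
        frobeniusEntry (Sum.map Nat.succ id i) z := by
    funext i
    rcases i with s | t
    · simp [deriv_frobeniusEntry_inl]
    · simp [deriv_frobeniusEntry_inr_succ]
  rw [e]
  refine listWronskian_const_mul _ ?_ _ _
  rintro (s | t)
  · simp
  · simp [Nat.cast_add_one_ne_zero]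

/-- The mirror case: multiplication by `e^{-x²}` turns the entry of `s = 0` into `1`, and
differentiation then lowers every other `s` and raises every `t`. -/
theorem listWronskian_inl_zero_cons (L : List (ℕ ⊕ ℕ)) :
    IsScalarMultiple
      (listWronskian frobeniusEntry (Sum.inl 0 :: L.map (Sum.map Nat.succ id)))
      (fun z => Complex.exp (z ^ 2) *
        listWronskian frobeniusEntry (L.map (Sum.map id Nat.succ)) z) := by
  have hg : ContDiff ℂ ⊤ fun x : ℂ => Complex.exp (-x ^ 2) := (contDiff_id.pow 2).neg.cexp
  have h1 := listWronskian_mul _ _ (Sum.inl 0 :: L.map (Sum.map Nat.succ id)) hg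
    contDiff_frobeniusEntry
  rw [listWronskian_cons_one _ _ _ (by
    funext z
    rw [exp_neg_sq_mul_frobeniusEntry_inl]
    simp [conjHermiteH, hermiteH]), listWronskian_map] at h1
  have e : (fun (i : ℕ ⊕ ℕ) => deriv fun x : ℂ =>
        Complex.exp (-x ^ 2) * frobeniusEntry (Sum.map Nat.succ id i) x) =
      fun (i : ℕ ⊕ ℕ) z => (Sum.elim (fun s : ℕ => 2 * ((s : ℂ) + 1)) (fun _ => -1) i) *
        (Complex.exp (-z ^ 2) * frobeniusEntry (Sum.map id Nat.succ i) z) := by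
    funext i z
    rcases i with s | t
    · simpa using deriv_exp_neg_sq_mul_frobeniusEntry_inl_succ s z
    · simpa using deriv_exp_neg_sq_mul_frobeniusEntry_inr t z
  rw [e] at h1
  obtain ⟨c, hc, h⟩ := listWronskian_const_mul
    (Sum.elim (fun s : ℕ => 2 * ((s : ℂ) + 1)) (fun _ => -1)) (by
      rintro (s | t)
      · simp [Nat.cast_add_one_ne_zero]
      · simp)
    (fun (i : ℕ ⊕ ℕ) z => Complex.exp (-z ^ 2) * frobeniusEntry (Sum.map id Nat.succ i) z) L
  refine ⟨c, hc, fun z => ?_⟩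
  have h2 := h1 z
  rw [h, listWronskian_mul _ _ _ hg fun _ => contDiff_frobeniusEntry _, ← listWronskian_map,
    List.length_cons, List.length_map] at h2
  have huv : Complex.exp (-z ^ 2) * Complex.exp (z ^ 2) = 1 := by simp [← Complex.exp_add]
  -- The list before the reduction has one entry more than the list after it, hence one more factor
  -- `e^{-z²}`; this leaves the `e^{z²}` of the statement.
  refine mul_left_cancel₀ (pow_ne_zero (L.length + 1) (Complex.exp_ne_zero (-z ^ 2))) ?_
  linear_combination -h2 - c * Complex.exp (-z ^ 2) ^ L.length *
    listWronskian frobeniusEntry (L.map (Sum.map id Nat.succ)) z * huv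

theorem exists_nodup_list_sum (A B : Finset ℕ) : ∃ L : List (ℕ ⊕ ℕ), L.Nodup ∧
    (∀ s, Sum.inl s ∈ L ↔ s ∈ A) ∧ ∀ t, Sum.inr t ∈ L ↔ t ∈ B :=
  ⟨(A.disjSum B).toList, Finset.nodup_toList _, by simp, by simp⟩

theorem MayaDiagram.mem_shift (M : MayaDiagram) (k m : ℤ) :
    m ∈ (M.shift k).carrier ↔ m - k ∈ M.carrier := by
  constructor
  · rintro ⟨n, hn, rfl⟩
    simpa using hn
  · exact fun h => ⟨m - k, h, by ring⟩

/-- The list `L` holds the holes of `M + 1` and the particles of `M`. Only the site `-1`, moved to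
`0`, crosses the origin: if filled it becomes a new particle, if empty a hole disappears. -/
theorem exists_isFrobeniusList_shift_one (M : MayaDiagram) : ∃ L : List (ℕ ⊕ ℕ),
    (IsFrobeniusList M (L.map (Sum.map Nat.succ id)) ∧
      IsFrobeniusList (M.shift 1) (Sum.inr 0 :: L.map (Sum.map id Nat.succ))) ∨
    (IsFrobeniusList M (Sum.inl 0 :: L.map (Sum.map Nat.succ id)) ∧
      IsFrobeniusList (M.shift 1) (L.map (Sum.map id Nat.succ))) := by
  obtain ⟨L, hL, hl, hr⟩ := exists_nodup_list_sum (M.shift 1).minus M.plus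
  simp only [MayaDiagram.mem_minus, MayaDiagram.mem_plus, MayaDiagram.mem_shift] at hl hr
  have n1 : (L.map (Sum.map Nat.succ id)).Nodup :=
    hL.map (Sum.map_injective.2 ⟨Nat.succ_injective, Function.injective_id⟩)
  have n2 : (L.map (Sum.map id Nat.succ)).Nodup :=
    hL.map (Sum.map_injective.2 ⟨Function.injective_id, Nat.succ_injective⟩)
  have e (s : ℕ) : -s - 1 - 1 = -1 + -(s : ℤ) - 1 := by ring
  refine ⟨L, ?_⟩
  by_cases h : (-1 : ℤ) ∈ M.carrier
  · refine Or.inl ⟨⟨n1, ?_, ?_⟩, ⟨List.nodup_cons.2 ⟨by simp, n2⟩, ?_, ?_⟩⟩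
    · rintro (_ | s)
      · simp [h]
      · simp [hl, e]
    · simp [hr]
    · simp [hl, MayaDiagram.mem_shift]
    · rintro (_ | t)
      · simp [h, MayaDiagram.mem_shift]
      · simp [hr, MayaDiagram.mem_shift]
  · refine Or.inr ⟨⟨List.nodup_cons.2 ⟨by simp, n1⟩, ?_, ?_⟩, ⟨n2, ?_, ?_⟩⟩
    · rintro (_ | s)
      · simp [h]
      · simp [hl, e]
    · simp [hr]
    · simp [hl, MayaDiagram.mem_shift]
    · rintro (_ | t)
      · simp [h, MayaDiagram.mem_shift]
      · simp [hr, MayaDiagram.mem_shift]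

theorem countP_isLeft_map (L : List (ℕ ⊕ ℕ)) (f g : ℕ → ℕ) :
    (L.map (Sum.map f g)).countP Sum.isLeft = L.countP Sum.isLeft := by
  rw [List.countP_map]
  congr 1
  funext i
  simp

theorem charge_shift_one (M : MayaDiagram) : (M.shift 1).charge = M.charge + 1 := by
  obtain ⟨L, ⟨h, h'⟩ | ⟨h, h'⟩⟩ := exists_isFrobeniusList_shift_one M <;>
  · rw [h.charge, h'.charge]
    simp [countP_isLeft_map, List.countP_cons, -List.countP_map]
    try ring

theorem pseudoWronskian_shift_one (M : MayaDiagram) :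
    IsScalarMultiple (pseudoWronskian M) (pseudoWronskian (M.shift 1)) := by
  obtain ⟨L, ⟨h, h'⟩ | ⟨h, h'⟩⟩ := exists_isFrobeniusList_shift_one M
  · refine h.pseudoWronskian.trans (IsScalarMultiple.trans ?_ h'.pseudoWronskian.symm)
    simpa [countP_isLeft_map, List.countP_cons, -List.countP_map] using
      (listWronskian_inr_zero_cons L).symm.mul_left _
  · refine h.pseudoWronskian.trans (IsScalarMultiple.trans ?_ h'.pseudoWronskian.symm)
    refine ((listWronskian_inl_zero_cons L).mul_left _).trans ?_
    convert IsScalarMultiple.refl _ using 1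
    funext z
    -- The extra `e^{z²}` compensates for the lost hole in the prefactor `e^{-rz²}`.
    rw [← mul_assoc, ← Complex.exp_add]
    congr 2
    simp [countP_isLeft_map, List.countP_cons, -List.countP_map]
    ring

theorem MayaDiagram.shift_shift (M : MayaDiagram) (a b : ℤ) :
    (M.shift a).shift b = M.shift (a + b) := by
  ext m
  simp only [MayaDiagram.mem_shift]
  rw [show m - b - a = m - (a + b) by ring]

theorem MayaDiagram.shift_zero (M : MayaDiagram) : M.shift 0 = M := by
  ext m
  simp [MayaDiagram.mem_shift]

theorem shift_natCast (M : MayaDiagram) (n : ℕ) : (M.shift n).charge = M.charge + n ∧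
    IsScalarMultiple (pseudoWronskian M) (pseudoWronskian (M.shift n)) := by
  induction n with
  | zero => simp [MayaDiagram.shift_zero, IsScalarMultiple.refl]
  | succ n ih =>
    rw [Nat.cast_add, Nat.cast_one, ← MayaDiagram.shift_shift, charge_shift_one, ih.1]
    exact ⟨by ring, ih.2.trans (pseudoWronskian_shift_one _)⟩

theorem charge_and_pseudoWronskian_shift (M : MayaDiagram) (k : ℤ) :
    (M.shift k).charge = M.charge + k ∧
      IsScalarMultiple (pseudoWronskian M) (pseudoWronskian (M.shift k)) := by
  obtain ⟨n, rfl | rfl⟩ := k.eq_nat_or_neg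
  · exact shift_natCast M n
  · have h := shift_natCast (M.shift (-n)) n
    rw [MayaDiagram.shift_shift, neg_add_cancel, MayaDiagram.shift_zero] at h
    exact ⟨by rw [h.1]; ring, h.2.symm⟩

theorem charge_shift (M : MayaDiagram) (k : ℤ) : (M.shift k).charge = M.charge + k :=
  (charge_and_pseudoWronskian_shift M k).1

theorem pseudoWronskian_shift (M : MayaDiagram) (k : ℤ) :
    IsScalarMultiple (pseudoWronskian M) (pseudoWronskian (M.shift k)) :=
  (charge_and_pseudoWronskian_shift M k).2

end Shift

/-! ### From pseudo-Wronskians to Hermite Wronskians. -/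

section Bilinear

open Polynomial

theorem wronskianDet_eval {n : ℕ} (f : Fin n → ℂ[X]) (z : ℂ) :
    wronskianDet (fun i x => (f i).eval x) z = (derivMinor f fun j => j).eval z := by
  have h (p : ℂ[X]) (j : ℕ) : iteratedDeriv j (fun x => p.eval x) = fun x =>
      (derivative^[j] p).eval x := by
    induction j with
    | zero => simp
    | succ j ih =>
      rw [iteratedDeriv_succ, ih, Function.iterate_succ_apply']
      exact funext fun x => Polynomial.deriv _
  rw [wronskianDet, derivMinor, ← coe_evalRingHom, RingHom.map_det]
  congr 1
  ext1 i j
  simp [h]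

/-- The translate by `N` has no holes, and the `t i` are its particles. -/
theorem charge_and_pseudoWronskian_of_mem_iff (M : MayaDiagram) (N : ℕ) {n : ℕ} (t : Fin n → ℕ)
    (ht : Function.Injective t)
    (h : ∀ m : ℤ, m ∈ M.carrier ↔ m + N < 0 ∨ ∃ i, m + N = t i) :
    M.charge = n - N ∧
      IsScalarMultiple (pseudoWronskian M) fun z => (hermiteWronskian t).eval z := by
  have hL : IsFrobeniusList (M.shift N) (List.ofFn fun i => Sum.inr (t i)) := by
    refine ⟨List.nodup_ofFn.2 fun i j hij => ht (by simpa using hij), fun s => ?_, fun r => ?_⟩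
    · rw [MayaDiagram.mem_shift, h]
      simp [List.mem_ofFn]
      omega
    · rw [MayaDiagram.mem_shift, h]
      simp [List.mem_ofFn, eq_comm]
  have h0 : (List.ofFn fun i => (Sum.inr (t i) : ℕ ⊕ ℕ)).countP Sum.isLeft = 0 := by
    rw [List.countP_eq_zero]
    simp [List.mem_ofFn]
  have hc := hL.charge
  have hw := hL.pseudoWronskian
  rw [h0, charge_shift, List.length_ofFn] at hc
  refine ⟨by push_cast at hc; linarith, (pseudoWronskian_shift M N).trans (hw.trans ?_)⟩
  convert IsScalarMultiple.refl _ using 1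
  funext z
  rw [h0, listWronskian_ofFn, hermiteWronskian, ← wronskianDet_eval]
  simp [frobeniusEntry]

theorem exists_mem_iff (M : MayaDiagram) (b : ℤ) : ∃ (N n : ℕ) (t : Fin n → ℕ),
    Function.Injective t ∧ 2 ≤ n ∧ -b ≤ N ∧
      ∀ m : ℤ, m ∈ M.carrier ↔ m + N < 0 ∨ ∃ i, m + N = t i := by
  obtain ⟨B, hB⟩ := M.finite_neg.bddBelow
  have hB' (m : ℤ) (h1 : m < B) (h2 : m < 0) : m ∈ M.carrier := by
    by_contra h
    exact absurd (hB ⟨h, h2⟩) (by omega)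
  -- All sites below `min B 0` are filled. This `N` moves at least two of them to the sites `0` and
  -- `1`, so that `2 ≤ n` as `hermiteWronskian_bilinear` requires, and it moves `b` to a
  -- non-negative site.
  let N : ℕ := (max (2 - min B 0) (-b)).toNat
  have hN1 : 2 - min B 0 ≤ N := by omega
  have hN2 : -b ≤ N := by omega
  have hmem (m : ℕ) : m ∈ (M.shift N).plus ↔ (m : ℤ) - N ∈ M.carrier := by
    rw [MayaDiagram.mem_plus, MayaDiagram.mem_shift]
  refine ⟨N, (M.shift N).plus.card, (M.shift N).plus.orderEmbOfFin rfl,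
    ((M.shift N).plus.orderEmbOfFin rfl).injective, ?_, hN2, fun m => ?_⟩
  · have : ({0, 1} : Finset ℕ) ⊆ (M.shift N).plus := by
      intro a ha
      rw [hmem]
      have : a ≤ 1 := by
        simp at ha
        omega
      exact hB' _ (by omega) (by omega)
    simpa using Finset.card_le_card this
  · rcases lt_or_ge (m + N) 0 with h | h
    · simp only [h, true_or, iff_true]
      exact hB' _ (by omega) (by omega)
    · obtain ⟨a, ha⟩ := Int.eq_ofNat_of_zero_le h
      rw [ha, show m = (a : ℤ) - N by omega, ← hmem, ← exists_orderEmbOfFin_eq_iff]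
      simp [eq_comm]

theorem IsScalarMultiple.eq_eval {f : ℂ → ℂ} {P : ℂ[X]}
    (h : IsScalarMultiple f fun z => P.eval z) (hP : P ≠ 0) :
    ∃ c : ℂ, C c * P ≠ 0 ∧ f = fun z => (C c * P).eval z := by
  obtain ⟨c, hc, h⟩ := h
  exact ⟨c, mul_ne_zero (by simpa using hc) hP, funext fun z => by simp [h]⟩

theorem exists_pseudoWronskian_eq_eval (M : MayaDiagram) :
    ∃ P : ℂ[X], P ≠ 0 ∧ pseudoWronskian M = fun z => P.eval z := by
  obtain ⟨N, n, t, ht, -, -, h⟩ := exists_mem_iff M 0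
  obtain ⟨c, hc⟩ := (charge_and_pseudoWronskian_of_mem_iff M N t ht h).2.eq_eval
    (hermiteWronskian_ne_zero t ht)
  exact ⟨_, hc⟩

theorem MayaDiagram.mem_flip (M : MayaDiagram) (m n : ℤ) :
    n ∈ (MayaDiagram.flip m M).carrier ↔ (n = m ∧ m ∉ M.carrier) ∨ (n ≠ m ∧ n ∈ M.carrier) := by
  unfold MayaDiagram.flip
  by_cases h : m ∈ M.carrier
  · simp [h, and_comm]
  · by_cases hn : n = m
    · simp [h, hn]
    · simp [h, hn]

theorem MayaDiagram.flip_flip (M : MayaDiagram) (m : ℤ) :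
    MayaDiagram.flip m (MayaDiagram.flip m M) = M := by
  ext n
  by_cases hn : n = m
  · subst hn
    simp [MayaDiagram.mem_flip]
  · simp [MayaDiagram.mem_flip, hn]

/-- The bilinear equation for the pseudo-Wronskians of `M` and `M ∪ {m}`. -/
theorem pseudoWronskian_bilinear (M : MayaDiagram) (m : ℤ) (hm : m ∉ M.carrier) :
    (MayaDiagram.flip m M).charge = M.charge + 1 ∧ ∃ P Q : ℂ[X],
      pseudoWronskian M = (fun z => P.eval z) ∧
      pseudoWronskian (MayaDiagram.flip m M) = (fun z => Q.eval z) ∧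
      derivative (derivative Q) * P - 2 * derivative Q * derivative P
        + Q * derivative (derivative P) - 2 * X * (derivative Q * P - derivative P * Q)
        + 2 * ((m : ℂ[X]) - (M.charge : ℂ[X])) * (P * Q) = 0 := by
  obtain ⟨N, n, t, ht, hn, hN, h⟩ := exists_mem_iff M m
  obtain ⟨a, ha⟩ := Int.eq_ofNat_of_zero_le (show 0 ≤ m + N by omega)
  have hat (i) : t i ≠ a := fun hi => hm ((h m).2 (Or.inr ⟨i, by rw [ha, hi]⟩))
  have ht' : Function.Injective (Fin.cons a t : Fin (n + 1) → ℕ) :=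
    Fin.cons_injective_iff.2 ⟨by simpa using hat, ht⟩
  have h' (x : ℤ) : x ∈ (MayaDiagram.flip m M).carrier ↔
      x + N < 0 ∨ ∃ i, x + N = ((Fin.cons a t : Fin (n + 1) → ℕ) i : ℕ) := by
    rw [MayaDiagram.mem_flip, Fin.exists_fin_succ, h x]
    simp only [Fin.cons_zero, Fin.cons_succ, hm, not_false_eq_true, and_true]
    by_cases hx : x = m
    · subst hx
      simp [ha]
    · have : x + N ≠ a := by omega
      simp [hx, this]
  obtain ⟨hc, hP⟩ := charge_and_pseudoWronskian_of_mem_iff M N t ht h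
  obtain ⟨hc', hQ⟩ := charge_and_pseudoWronskian_of_mem_iff _ N _ ht' h'
  obtain ⟨c, -, hP⟩ := hP.eq_eval (hermiteWronskian_ne_zero t ht)
  obtain ⟨d, -, hQ⟩ := hQ.eq_eval (hermiteWronskian_ne_zero _ ht')
  refine ⟨by rw [hc, hc']; push_cast; ring, _, _, hP, hQ, ?_⟩
  have hb := hermiteWronskian_bilinear hn t a _ _ rfl rfl
  have e : (m : ℂ[X]) - (M.charge : ℂ[X]) = (a : ℂ[X]) - (n : ℂ[X]) := by
    rw [hc, show m = (a : ℤ) - N by omega]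
    push_cast
    ring
  rw [e]
  simp only [derivative_mul, derivative_C, zero_mul, zero_add]
  -- The equation is linear in each of `P` and `Q`, so the normalising constants factor out.
  linear_combination (C c * C d) * hb

theorem hasDerivAt_logDeriv_eval (P : ℂ[X]) {z : ℂ} (hz : P.eval z ≠ 0) :
    HasDerivAt (fun x => deriv (fun y => P.eval y) x / P.eval x)
      (((derivative (derivative P)).eval z * P.eval z -
        (derivative P).eval z * (derivative P).eval z) / P.eval z ^ 2) z := by
  simp only [Polynomial.deriv]
  exact ((derivative P).hasDerivAt z).div (P.hasDerivAt z) hz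

end Bilinear

/-! ### Potentials and Riccati equations. -/

/-- The Schrödinger potential attached to `M`, normalised by the charge. -/
noncomputable def mayaPotential (M : MayaDiagram) (z : ℂ) : ℂ :=
  z ^ 2 - 2 * deriv (fun x => deriv (pseudoWronskian M) x / pseudoWronskian M x) z
    + 2 * (M.charge : ℂ) - 1

theorem mayaPotential_shift (M : MayaDiagram) (k : ℤ) (z : ℂ) :
    mayaPotential (M.shift k) z = mayaPotential M z + 2 * k := by
  obtain ⟨c, hc, h⟩ := pseudoWronskian_shift M k
  have e : (fun x => deriv (pseudoWronskian M) x / pseudoWronskian M x) =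
      fun x => deriv (pseudoWronskian (M.shift k)) x / pseudoWronskian (M.shift k) x := by
    rw [show pseudoWronskian M = fun z => c * pseudoWronskian (M.shift k) z from funext h]
    funext x
    rw [deriv_const_mul_field, mul_div_mul_left _ _ hc]
  rw [mayaPotential, mayaPotential, e, charge_shift]
  push_cast
  ring

/-- With denominators cleared, both equations become the bilinear equation; the increase of the
charge by one absorbs the change of sign of `(-z)'`. -/
theorem riccati_of_notMem (M : MayaDiagram) (m : ℤ) (hm : m ∉ M.carrier) {w : ℂ → ℂ}
    (hw : ∀ z, w z = -z
      + deriv (pseudoWronskian (MayaDiagram.flip m M)) z / pseudoWronskian (MayaDiagram.flip m M) z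
      - deriv (pseudoWronskian M) z / pseudoWronskian M z)
    {z : ℂ} (hz : pseudoWronskian M z ≠ 0) (hz' : pseudoWronskian (MayaDiagram.flip m M) z ≠ 0) :
    DifferentiableAt ℂ w z ∧ deriv w z + w z ^ 2 = mayaPotential M z - 2 * m ∧
      -deriv w z + w z ^ 2 = mayaPotential (MayaDiagram.flip m M) z - 2 * m := by
  obtain ⟨hc, P, Q, hP, hQ, hb⟩ := pseudoWronskian_bilinear M m hm
  rw [hP] at hz
  rw [hQ] at hz'
  rw [hP, hQ] at hw
  have dP := hasDerivAt_logDeriv_eval P hz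
  have dQ := hasDerivAt_logDeriv_eval Q hz'
  have dw := (((hasDerivAt_neg z).add dQ).sub dP).congr_of_eventuallyEq
    (Filter.Eventually.of_forall hw)
  have hb := congrArg (Polynomial.eval z) hb
  simp only [Polynomial.eval_add, Polynomial.eval_sub, Polynomial.eval_mul, Polynomial.eval_ofNat,
    Polynomial.eval_X, Polynomial.eval_intCast, Polynomial.eval_zero] at hb
  refine ⟨dw.differentiableAt, ?_, ?_⟩
  · rw [dw.deriv, hw, mayaPotential, hP, dP.deriv]
    simp only [Polynomial.deriv]
    field_simp
    linear_combination (Polynomial.eval z P * Polynomial.eval z Q) * hb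
  · rw [dw.deriv, hw, mayaPotential, hQ, dQ.deriv, hc]
    simp only [Polynomial.deriv]
    push_cast
    field_simp
    linear_combination (Polynomial.eval z P * Polynomial.eval z Q) * hb

theorem riccati (M : MayaDiagram) (m : ℤ) {s : ℂ} (hs : m ∉ M.carrier → s = -1)
    (hs' : m ∈ M.carrier → s = 1) {w : ℂ → ℂ}
    (hw : ∀ z, w z = s * z
      + deriv (pseudoWronskian (MayaDiagram.flip m M)) z / pseudoWronskian (MayaDiagram.flip m M) z
      - deriv (pseudoWronskian M) z / pseudoWronskian M z)
    {z : ℂ} (hz : pseudoWronskian M z ≠ 0) (hz' : pseudoWronskian (MayaDiagram.flip m M) z ≠ 0) :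
    DifferentiableAt ℂ w z ∧ deriv w z + w z ^ 2 = mayaPotential M z - 2 * m ∧
      -deriv w z + w z ^ 2 = mayaPotential (MayaDiagram.flip m M) z - 2 * m := by
  by_cases hm : m ∈ M.carrier
  · have h := riccati_of_notMem (MayaDiagram.flip m M) m (by simp [MayaDiagram.mem_flip, hm])
      (w := -w) (fun x => by
        rw [MayaDiagram.flip_flip, Pi.neg_apply, hw, hs' hm]
        ring) (z := z) hz' (by rwa [MayaDiagram.flip_flip])
    rw [MayaDiagram.flip_flip, deriv.neg] at h
    obtain ⟨h1, h2, h3⟩ := h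
    refine ⟨by simpa using h1.neg, ?_, ?_⟩
    · rw [← h3]
      simp
    · rw [← h2]
      simp
  · exact riccati_of_notMem M m hm (fun x => by rw [hw, hs hm]; ring) hz hz'

/-! ### The chain of flips and its closure. -/

theorem mem_flips_iff {p : ℕ} (μ : Fin (p + 1) → ℤ)
    (hμ : Function.Injective fun i : Fin p => μ i.castSucc) (Mc : Fin (p + 1) → MayaDiagram)
    (hMc : ∀ i : Fin p, Mc i.succ = MayaDiagram.flip (μ i.castSucc) (Mc i.castSucc))
    (i : Fin (p + 1)) (m : ℤ) :
    m ∈ (Mc i).carrier ↔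
      Xor (m ∈ (Mc 0).carrier) (∃ j : Fin p, (j : ℕ) < i ∧ μ j.castSucc = m) := by
  induction i using Fin.induction with
  | zero => simp [Xor]
  | succ i ih =>
    have e : (∃ j : Fin p, (j : ℕ) < i.succ ∧ μ j.castSucc = m) ↔
        m = μ i.castSucc ∨ ∃ j : Fin p, (j : ℕ) < i.castSucc ∧ μ j.castSucc = m := by
      constructor
      · rintro ⟨j, hj, rfl⟩
        rcases Nat.lt_succ_iff_lt_or_eq.1 hj with h | h
        · exact Or.inr ⟨j, h, rfl⟩
        · exact Or.inl (by rw [Fin.ext h])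
      · rintro (rfl | ⟨j, hj, rfl⟩)
        · exact ⟨i, by simp, rfl⟩
        · exact ⟨j, hj.trans (by simp), rfl⟩
    rw [hMc, MayaDiagram.mem_flip, e]
    by_cases hm : m = μ i.castSucc
    · have hn : ¬ ∃ j : Fin p, (j : ℕ) < i.castSucc ∧ μ j.castSucc = m := by
        rintro ⟨j, hj, h⟩
        have : j = i := hμ (h.trans hm)
        simp [this] at hj
      rw [← hm, ih]
      simp only [hn, Xor]
      tauto
    · simp [hm, ih]

theorem mem_upsilon_iff (M M' : MayaDiagram) (m : ℤ) :
    m ∈ M.upsilon M' ↔ Xor (m ∈ M.carrier) (m ∈ M'.carrier) := by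
  simp [MayaDiagram.upsilon, Xor]

theorem sum_castSucc_sub_succ {R : Type*} [CommRing R] {p : ℕ} (f : Fin (p + 1) → R) :
    ∑ i : Fin p, (f i.castSucc - f i.succ) = f 0 - f (Fin.last p) := by
  rw [Finset.sum_sub_distrib]
  linear_combination (Fin.sum_univ_succ f) - (Fin.sum_univ_castSucc f)

theorem mainTheorem2
    (M : MayaDiagram) (k : ℤ) (hk : k ≠ 0)
    (p : ℕ) (hp : p = (M.upsilon (M.shift k)).card)
    -- `μ 0, …, μ (p - 1)` is an arbitrary enumeration of `Υ(M, M + k)`, and `μ p = μ 0 + k`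
    (μ : Fin (p + 1) → ℤ)
    (hμ_inj : Function.Injective fun i : Fin p => μ i.castSucc)
    (hμ_range : ∀ m : ℤ, m ∈ M.upsilon (M.shift k) ↔ ∃ i : Fin p, μ i.castSucc = m)
    (hμ_last : μ (Fin.last p) = μ 0 + k)
    -- the chain of flips `M_0 = M`, `M_{i+1} = φ_{μ_i}(M_i)`
    (Mc : Fin (p + 1) → MayaDiagram)
    (hMc_zero : Mc 0 = M)
    (hMc_succ : ∀ i : Fin p, Mc i.succ = MayaDiagram.flip (μ i.castSucc) (Mc i.castSucc))
    (s : Fin p → ℂ)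
    (hs_notMem : ∀ i : Fin p, μ i.castSucc ∉ M.carrier → s i = -1)
    (hs_mem : ∀ i : Fin p, μ i.castSucc ∈ M.carrier → s i = 1)
    (w : Fin p → ℂ → ℂ)
    (hw : ∀ (i : Fin p) (z : ℂ), w i z = s i * z
      + deriv (pseudoWronskian (Mc i.succ)) z / pseudoWronskian (Mc i.succ) z
      - deriv (pseudoWronskian (Mc i.castSucc)) z / pseudoWronskian (Mc i.castSucc) z)
    (α : Fin p → ℂ)
    (hα : ∀ i : Fin p, α i = 2 * ((μ i.castSucc : ℂ) - (μ i.succ : ℂ))) :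
    Mc (Fin.last p) = M.shift k ∧
    (∀ i : Fin (p + 1), ∃ P : Polynomial ℂ, P ≠ 0 ∧
      ∀ z : ℂ, pseudoWronskian (Mc i) z = P.eval z) ∧
    IsRationalDressingChainOn {z : ℂ | ∀ i : Fin (p + 1), pseudoWronskian (Mc i) z ≠ 0}
      w α (2 * (k : ℂ)) := by

  have hmem := mem_flips_iff μ hμ_inj Mc hMc_succ
  rw [hMc_zero] at hmem
  have hlast : Mc (Fin.last p) = M.shift k := by
    ext m
    have h1 := hμ_range m
    rw [mem_upsilon_iff] at h1
    rw [hmem]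
    simp only [Fin.val_last, Fin.is_lt, true_and]
    rw [← h1]
    simp only [Xor]
    tauto
  -- The signs `s i` refer to `M`, while `riccati` needs membership in `M_i`; the two agree because
  -- `μ_i` has not been flipped before step `i`.
  have hmem_iff (i : Fin p) : μ i.castSucc ∈ (Mc i.castSucc).carrier ↔ μ i.castSucc ∈ M.carrier := by
    have hn : ¬ ∃ j : Fin p, (j : ℕ) < i.castSucc ∧ μ j.castSucc = μ i.castSucc := by
      rintro ⟨j, hj, h⟩
      have : j = i := hμ_inj h
      simp [this] at hj
    rw [hmem]
    simp only [hn, Xor]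
    tauto
  have hpoly (i : Fin (p + 1)) := exists_pseudoWronskian_eq_eval (Mc i)
  have hric (i : Fin p) (z : ℂ) (hz : ∀ i : Fin (p + 1), pseudoWronskian (Mc i) z ≠ 0) :
      DifferentiableAt ℂ (w i) z ∧
        deriv (w i) z + w i z ^ 2 = mayaPotential (Mc i.castSucc) z - 2 * μ i.castSucc ∧
        -deriv (w i) z + w i z ^ 2 = mayaPotential (Mc i.succ) z - 2 * μ i.castSucc := by
    have h1 := hz i.succ
    have h2 := hw i
    rw [hMc_succ] at h1 h2 ⊢
    exact riccati _ _ (fun h => hs_notMem i (mt (hmem_iff i).2 h))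
      (fun h => hs_mem i ((hmem_iff i).1 h)) h2 (hz _) h1
  -- This identity allows the index to be read modulo `p`. It is only substantial at the last index,
  -- where the `2k` gained by the potential cancels against `μ_p = μ_0 + k`.
  have hnext (i : Fin p) (z : ℂ) : mayaPotential (Mc i.succ) z - 2 * μ i.succ =
      mayaPotential (Mc (finRotate p i).castSucc) z - 2 * μ (finRotate p i).castSucc := by
    obtain _ | q := p
    · exact i.elim0
    rcases Fin.eq_castSucc_or_eq_last i with ⟨j, rfl⟩ | rfl
    · rw [finRotate_apply, Fin.coeSucc_eq_succ, Fin.succ_castSucc]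
    · rw [finRotate_last, Fin.succ_last, hlast, hμ_last, mayaPotential_shift, Fin.castSucc_zero,
        hMc_zero]
      push_cast
      ring
  refine ⟨hlast, fun i => ?_, ⟨fun i z hz => (hric i z hz).1, fun i z hz => ?_, ?_⟩, ?_,
    fun i => ?_⟩
  · obtain ⟨P, hP, h⟩ := hpoly i
    exact ⟨P, hP, congrFun h⟩
  · obtain ⟨d1, -, h1⟩ := hric i z hz
    obtain ⟨d2, h2, -⟩ := hric (finRotate p i) z hz
    rw [deriv_fun_add d1 d2, hα]
    linear_combination h2 - h1 - hnext i z
  · simp only [hα]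
    -- The sum telescopes to `2(μ_0 - μ_p) = -2k`.
    rw [← Finset.mul_sum, sum_castSucc_sub_succ fun i => (μ i : ℂ), hμ_last]
    push_cast
    ring
  · have e : {z : ℂ | ∀ i : Fin (p + 1), pseudoWronskian (Mc i) z ≠ 0}ᶜ =
        ⋃ i : Fin (p + 1), {z : ℂ | pseudoWronskian (Mc i) z = 0} := by
      ext z
      simp
    rw [e]
    refine Set.finite_iUnion fun i => ?_
    obtain ⟨P, hP, h⟩ := hpoly i
    rw [h]
    exact Polynomial.finite_setOfPred_isRoot hP
  · obtain ⟨P, -, hP⟩ := hpoly i.castSucc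
    obtain ⟨Q, -, hQ⟩ := hpoly i.succ
    refine ⟨Polynomial.C (s i) * Polynomial.X * Q * P + Polynomial.derivative Q * P
      - Polynomial.derivative P * Q, Q * P, fun z hz => ?_⟩
    have hzP := hz i.castSucc
    have hzQ := hz i.succ
    rw [hP] at hzP
    rw [hQ] at hzQ
    refine ⟨by simpa using ⟨hzQ, hzP⟩, ?_⟩
    rw [hw, hP, hQ]
    simp only [Polynomial.deriv, Polynomial.eval_add, Polynomial.eval_sub, Polynomial.eval_mul,
      Polynomial.eval_C, Polynomial.eval_X]
    field_simp
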